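/- For complex numbers $a,q$ with $|q|<1$ put $(a;q)_n=\prod_{k=0}^{n-1}(1-aq^k)$ and $(a;q)_\infty=\prod_{k=0}^{\infty}(1-aq^k)$, and let $$\phi(q)=\sum_{n=0}^{\infty}\frac{q^{n^2}}{(-q^2;q^2)_n}$$ be Ramanujan's third order mock theta function. For $n\ge 1$ let $p^e_{do}(n)$ denote the number of partitions of $n$ into an even number of distinct parts whose smallest part is odd. Then, for every complex $q$ with $|q|<1$, the infinite product $(-q;q)_\infty$ and the series below converge, no denominator in the series for $\phi(-q)$ vanishes, and $$(-q;q)_\infty\,\phi(-q)=1+2\sum_{n\ge 1}p^e_{do}(n)\,q^n .$$ -/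

import Mathlib

/-- The finite `q`-shifted factorial `(a;q)_n = (1 - a)(1 - aq)⋯(1 - aq^{n-1})`. -/
noncomputable def qPoch (a q : ℂ) (n : ℕ) : ℂ :=
  ∏ k ∈ Finset.range n, (1 - a * q ^ k)

/-- The infinite `q`-shifted factorial `(a;q)_∞ = ∏_{k ≥ 0} (1 - aq^k)`, for `|q| < 1`. -/
noncomputable def qPochInf (a q : ℂ) : ℂ :=
  ∏' k : ℕ, (1 - a * q ^ k)

/-- The `n`-th term `q^{n²} / (-q²;q²)_n` of the series that defines `φ(q)`. -/
noncomputable def mockPhiTerm (q : ℂ) (n : ℕ) : ℂ :=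
  q ^ (n ^ 2) / qPoch (-q ^ 2) (q ^ 2) n

/-- Ramanujan's third order mock theta function `φ(q) = ∑_{n ≥ 0} q^{n²} / (-q²;q²)_n`. -/
noncomputable def mockPhi (q : ℂ) : ℂ :=
  ∑' n : ℕ, mockPhiTerm q n

/-- The partition `p` has a smallest part (so `p` is non-empty), and that part is odd. -/
def SmallestPartOdd {n : ℕ} (p : n.Partition) : Prop :=
  ∃ m ∈ p.parts, (∀ i ∈ p.parts, m ≤ i) ∧ Odd m

/-- The number `p^e_do(n)` of partitions of `n` into an even number of distinct parts
with odd smallest part. -/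
noncomputable def pEvenDO (n : ℕ) : ℕ :=
  Nat.card {p : n.Partition // p.parts.Nodup ∧ Even p.parts.card ∧ SmallestPartOdd p}

/-!
The proof rests on an identity with a free parameter `x`, valid for `|q| < 1` and all complex `x`:
`(x; q²)_∞ ∑ (-1)ⁿ q^{n²} (x q^{2n+1}; q²)_∞ + ∑ x q^{2k} (x q^{2k+1}; q)_∞ = ∑ (-1)ⁿ q^{n²}`
(`thetaPochSum_add_gapPochSum`). Peeling off one factor of each product shows that the left side
does not change under `x ↦ x q²`, so it equals its limit as `x → 0`, which is the right side.

At `x = -q` the first summand is `(-q; q)_∞ φ(-q)`, and the second is `-A`, where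
`A = ∑ q^{2k+1} (-q^{2k+2}; q)_∞`. At `x = 1` the first summand vanishes, and the second is the
even-indexed half of the telescoping sum `∑ qᵐ (q^{m+1}; q)_∞ = 1`; so the right side is `1 - B`
with `B = ∑ q^{2k+1} (q^{2k+2}; q)_∞`. Hence `(-q; q)_∞ φ(-q) = 1 + A - B`
(`qPochInf_mul_mockPhi`).

Expanding the products, `A` counts the partitions into distinct parts with odd smallest part
`2k + 1`, and `B` counts them with the sign `(-1)^(number of parts - 1)`. So `A - B` counts twice
those with an even number of parts (`hasSum_pEvenDO`).
-/

open Filter Topology Finset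

/-! ### Infinite `q`-shifted factorials -/

theorem summable_norm_mul_pow {q : ℂ} (hq : ‖q‖ < 1) (a : ℂ) :
    Summable fun k : ℕ => ‖-(a * q ^ k)‖ := by
  simpa [norm_mul, norm_pow] using
    (summable_geometric_of_lt_one (norm_nonneg q) hq).mul_left ‖a‖

theorem multipliable_one_sub_mul_pow {q : ℂ} (hq : ‖q‖ < 1) (a : ℂ) :
    Multipliable fun k : ℕ => 1 - a * q ^ k := by
  simpa [sub_eq_add_neg] using multipliable_one_add_of_summable (summable_norm_mul_pow hq a)

theorem hasProd_qPochInf {q : ℂ} (hq : ‖q‖ < 1) (a : ℂ) :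
    HasProd (fun k : ℕ => 1 - a * q ^ k) (qPochInf a q) :=
  (multipliable_one_sub_mul_pow hq a).hasProd

theorem norm_sq_lt_one {q : ℂ} (hq : ‖q‖ < 1) : ‖q ^ 2‖ < 1 := by
  rw [norm_pow]
  exact pow_lt_one₀ (norm_nonneg q) hq two_ne_zero

theorem qPochInf_eq_one_sub_mul {q : ℂ} (hq : ‖q‖ < 1) (a : ℂ) :
    qPochInf a q = (1 - a) * qPochInf (a * q) q := by
  have h : HasProd (fun k : ℕ => 1 - a * q ^ (k + 1)) (qPochInf (a * q) q) := by
    simpa only [pow_succ', mul_assoc] using hasProd_qPochInf hq (a * q)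
  have h2 : HasProd (fun k : ℕ => 1 - a * q ^ k) ((1 - a * q ^ 0) * qPochInf (a * q) q) :=
    h.zero_mul
  rw [pow_zero, mul_one] at h2
  exact (hasProd_qPochInf hq a).unique h2

theorem qPochInf_eq_qPoch_mul {q : ℂ} (hq : ‖q‖ < 1) (a : ℂ) (n : ℕ) :
    qPochInf a q = qPoch a q n * qPochInf (a * q ^ n) q := by
  induction n with
  | zero => simp [qPoch]
  | succ n ih =>
    rw [ih, qPochInf_eq_one_sub_mul hq (a * q ^ n), qPoch, qPoch, prod_range_succ, pow_succ]
    ring_nf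

/-- Separation of the even and the odd powers of `q`. -/
theorem qPochInf_sq_mul_qPochInf_sq {q : ℂ} (hq : ‖q‖ < 1) (a : ℂ) :
    qPochInf a (q ^ 2) * qPochInf (a * q) (q ^ 2) = qPochInf a q := by
  have he : HasProd (fun k : ℕ => 1 - a * q ^ (2 * k)) (qPochInf a (q ^ 2)) := by
    simpa only [pow_mul] using hasProd_qPochInf (norm_sq_lt_one hq) a
  have ho : HasProd (fun k : ℕ => 1 - a * q ^ (2 * k + 1)) (qPochInf (a * q) (q ^ 2)) :=
    (hasProd_qPochInf (norm_sq_lt_one hq) (a * q)).congr_fun fun k => by ring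
  exact (HasProd.even_mul_odd (f := fun k : ℕ => 1 - a * q ^ k) he ho).unique
    (hasProd_qPochInf hq a)

theorem tendsto_qPochInf_mul_pow {q p : ℂ} (hq : ‖q‖ < 1) (hp : ‖p‖ < 1) (a : ℂ) :
    Tendsto (fun n : ℕ => qPochInf (a * p ^ n) q) atTop (𝓝 1) := by
  have key := tendsto_tprod_one_add_of_dominated_convergence (𝓕 := atTop)
    (f := fun (n k : ℕ) => -(a * p ^ n * q ^ k)) (g := fun _ : ℕ => (0 : ℂ))
    (bound := fun k => ‖-(a * q ^ k)‖) (summable_norm_mul_pow hq a) ?_ ?_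
  · simpa [qPochInf, sub_eq_add_neg] using key
  · intro k
    have := (tendsto_pow_atTop_nhds_zero_of_norm_lt_one hp).const_mul (-(a * q ^ k))
    simp only [mul_zero] at this
    exact this.congr fun n => by ring
  · refine .of_forall fun n k => ?_
    simp only [norm_neg, norm_mul, norm_pow]
    have : ‖p‖ ^ n ≤ 1 := pow_le_one₀ (norm_nonneg p) hp.le
    gcongr
    exact mul_le_of_le_one_right (norm_nonneg a) this

theorem exists_norm_qPochInf_mul_pow_le {q p : ℂ} (hq : ‖q‖ < 1) (hp : ‖p‖ < 1) (a : ℂ) :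
    ∃ C : ℝ, ∀ n : ℕ, ‖qPochInf (a * p ^ n) q‖ ≤ C := by
  obtain ⟨C, hC⟩ := (tendsto_qPochInf_mul_pow hq hp a).norm.bddAbove_range
  exact ⟨C, fun n => hC ⟨n, rfl⟩⟩

/-! ### A two-term expansion of the partial theta series -/

theorem summable_norm_pow_sq {q : ℂ} (hq : ‖q‖ < 1) : Summable fun n : ℕ => ‖q‖ ^ n ^ 2 :=
  (summable_geometric_of_lt_one (norm_nonneg q) hq).of_nonneg_of_le
    (fun n => by positivity)
    fun n => pow_le_pow_of_le_one (norm_nonneg q) hq.le (Nat.le_self_pow two_ne_zero n)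

/-- The series `∑ (-1)ⁿ q^{n²} (x q^{2n+1}; q²)_∞`. At `x = -q` it is `(-q²; q²)_∞ φ(-q)`. -/
noncomputable def thetaPochSum (q x : ℂ) : ℂ :=
  ∑' n : ℕ, (-1) ^ n * q ^ n ^ 2 * qPochInf (x * q ^ (2 * n + 1)) (q ^ 2)

/-- The series `∑ x q^{2k} (x q^{2k+1}; q)_∞`. At `x = -cq` with `c = ±1` it is, up to the
factor `-c`, the generating function of the partitions into distinct parts with odd smallest part,
where each part other than the smallest carries the weight `c`. -/
noncomputable def gapPochSum (q x : ℂ) : ℂ :=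
  ∑' k : ℕ, x * q ^ (2 * k) * qPochInf (x * q ^ (2 * k + 1)) q

theorem summable_thetaPochSum {q : ℂ} (hq : ‖q‖ < 1) (x : ℂ) :
    Summable fun n : ℕ => (-1) ^ n * q ^ n ^ 2 * qPochInf (x * q ^ (2 * n + 1)) (q ^ 2) := by
  obtain ⟨C, hC⟩ := exists_norm_qPochInf_mul_pow_le (norm_sq_lt_one hq) hq x
  refine ((summable_norm_pow_sq hq).mul_right C).of_norm_bounded fun n => ?_
  simp only [norm_mul, norm_pow, norm_neg, norm_one, one_pow, one_mul]
  gcongr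
  exact hC _

theorem summable_pow_mul_qPochInf {q : ℂ} (hq : ‖q‖ < 1) (x : ℂ) :
    Summable fun m : ℕ => q ^ m * qPochInf (x * q ^ (m + 1)) q := by
  obtain ⟨C, hC⟩ := exists_norm_qPochInf_mul_pow_le hq hq x
  refine ((summable_geometric_of_lt_one (norm_nonneg q) hq).mul_right C).of_norm_bounded
    fun n => ?_
  simp only [norm_mul, norm_pow]
  gcongr
  exact hC _

theorem summable_gapPochSum {q : ℂ} (hq : ‖q‖ < 1) (x : ℂ) :
    Summable fun k : ℕ => x * q ^ (2 * k) * qPochInf (x * q ^ (2 * k + 1)) q := by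
  have h := (summable_pow_mul_qPochInf hq x).comp_injective
    (i := fun k : ℕ => 2 * k) fun a b h => by simpa using h
  exact (h.mul_left x).congr fun k => by simp [mul_assoc]

theorem thetaPochSum_mul_sq {q : ℂ} (hq : ‖q‖ < 1) (x : ℂ) :
    thetaPochSum q (x * q ^ 2) = (1 - x) * thetaPochSum q x + x * qPochInf (x * q) (q ^ 2) := by
  have hs := summable_thetaPochSum hq x
  have hs2 := summable_thetaPochSum hq (x * q ^ 2)
  have h0 : thetaPochSum q x = qPochInf (x * q) (q ^ 2) + ∑' n : ℕ, (-1) ^ (n + 1) *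
      q ^ (n + 1) ^ 2 * qPochInf (x * q ^ (2 * (n + 1) + 1)) (q ^ 2) := by
    rw [thetaPochSum, hs.tsum_eq_zero_add]
    simp
  have h1 : thetaPochSum q x = thetaPochSum q (x * q ^ 2) + x * ∑' n : ℕ, (-1) ^ (n + 1) *
      q ^ (n + 1) ^ 2 * qPochInf (x * q ^ (2 * (n + 1) + 1)) (q ^ 2) := by
    rw [thetaPochSum, thetaPochSum, ← tsum_mul_left,
      ← hs2.tsum_add (((summable_nat_add_iff 1).2 hs).mul_left x)]
    refine tsum_congr fun n => ?_
    rw [qPochInf_eq_one_sub_mul (norm_sq_lt_one hq) (x * q ^ (2 * n + 1))]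
    have e1 : x * q ^ (2 * n + 1) * q ^ 2 = x * q ^ (2 * (n + 1) + 1) := by ring
    have e2 : x * q ^ 2 * q ^ (2 * n + 1) = x * q ^ (2 * (n + 1) + 1) := by ring
    rw [e1, e2]
    ring
  linear_combination x * h0 - h1

theorem gapPochSum_mul_sq {q : ℂ} (hq : ‖q‖ < 1) (x : ℂ) :
    gapPochSum q x = x * qPochInf (x * q) q + gapPochSum q (x * q ^ 2) := by
  rw [gapPochSum, (summable_gapPochSum hq x).tsum_eq_zero_add, gapPochSum]
  congr 1
  · simp
  · refine tsum_congr fun k => ?_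
    congr 1
    · ring
    · congr 1
      ring

/-- Under `x ↦ x q²` the factorial loses, and the theta series gains, a factor `1 - x`; the gap
series absorbs the inhomogeneous term. -/
theorem thetaPochSum_add_gapPochSum_mul_sq {q : ℂ} (hq : ‖q‖ < 1) (x : ℂ) :
    qPochInf (x * q ^ 2) (q ^ 2) * thetaPochSum q (x * q ^ 2) + gapPochSum q (x * q ^ 2) =
      qPochInf x (q ^ 2) * thetaPochSum q x + gapPochSum q x := by
  rw [thetaPochSum_mul_sq hq, gapPochSum_mul_sq hq x,
    qPochInf_eq_one_sub_mul (norm_sq_lt_one hq) x, ← qPochInf_sq_mul_qPochInf_sq hq (x * q),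
    mul_assoc x q q, ← pow_two]
  ring

theorem tendsto_thetaPochSum {q : ℂ} (hq : ‖q‖ < 1) (x : ℂ) :
    Tendsto (fun N : ℕ => thetaPochSum q (x * (q ^ 2) ^ N)) atTop
      (𝓝 (∑' n : ℕ, (-1) ^ n * q ^ n ^ 2)) := by
  have hq2 := norm_sq_lt_one hq
  obtain ⟨C, hC⟩ := exists_norm_qPochInf_mul_pow_le hq2 hq x
  refine tendsto_tsum_of_dominated_convergence ((summable_norm_pow_sq hq).mul_right C) ?_ ?_
  · intro n
    have := (tendsto_qPochInf_mul_pow hq2 hq2 (x * q ^ (2 * n + 1))).const_mul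
      ((-1) ^ n * q ^ n ^ 2)
    rw [mul_one] at this
    exact this.congr fun N => by ring_nf
  · refine .of_forall fun N n => ?_
    simp only [norm_mul, norm_pow, norm_neg, norm_one, one_pow, one_mul]
    gcongr
    rw [← pow_mul, mul_assoc, ← pow_add]
    exact hC _

theorem tendsto_gapPochSum (q x : ℂ) :
    Tendsto (fun N : ℕ => gapPochSum q (x * (q ^ 2) ^ N)) atTop (𝓝 0) := by
  refine (tendsto_sum_nat_add
    fun k : ℕ => x * q ^ (2 * k) * qPochInf (x * q ^ (2 * k + 1)) q).congr fun N => ?_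
  refine tsum_congr fun k => ?_
  congr 1
  · ring
  · congr 1
    ring

/-- The left side is invariant under `x ↦ x q²`, hence equal to its limit as `x → 0`. -/
theorem thetaPochSum_add_gapPochSum {q : ℂ} (hq : ‖q‖ < 1) (x : ℂ) :
    qPochInf x (q ^ 2) * thetaPochSum q x + gapPochSum q x = ∑' n : ℕ, (-1) ^ n * q ^ n ^ 2 := by
  have hq2 := norm_sq_lt_one hq
  have hconst : ∀ N : ℕ, qPochInf (x * (q ^ 2) ^ N) (q ^ 2) * thetaPochSum q (x * (q ^ 2) ^ N) +
      gapPochSum q (x * (q ^ 2) ^ N) = qPochInf x (q ^ 2) * thetaPochSum q x + gapPochSum q x := by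
    intro N
    induction N with
    | zero => simp
    | succ N ih =>
      rw [pow_succ, ← mul_assoc, thetaPochSum_add_gapPochSum_mul_sq hq, ih]
  have hlim := ((tendsto_qPochInf_mul_pow hq2 hq2 x).mul (tendsto_thetaPochSum hq x)).add
    (tendsto_gapPochSum q x)
  rw [one_mul, add_zero] at hlim
  exact tendsto_nhds_unique (tendsto_const_nhds.congr fun N => (hconst N).symm) hlim

/-- `∑ qᵐ (q^{m+1}; q)_∞ = 1`, a telescoping sum. -/
theorem hasSum_pow_mul_qPochInf {q : ℂ} (hq : ‖q‖ < 1) :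
    HasSum (fun m : ℕ => q ^ m * qPochInf (q ^ (m + 1)) q) 1 := by
  have hs : Summable fun m : ℕ => q ^ m * qPochInf (q ^ (m + 1)) q := by
    simpa using summable_pow_mul_qPochInf hq 1
  have hpart : ∀ n : ℕ, ∑ m ∈ range n, q ^ m * qPochInf (q ^ (m + 1)) q = qPochInf (q ^ n) q := by
    intro n
    induction n with
    | zero => simp [qPochInf_eq_one_sub_mul hq 1]
    | succ n ih =>
      rw [sum_range_succ, ih, qPochInf_eq_one_sub_mul hq (q ^ n), ← pow_succ]
      ring
  have hlim : Tendsto (fun n : ℕ => qPochInf (q ^ n) q) atTop (𝓝 1) := by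
    simpa using tendsto_qPochInf_mul_pow hq hq 1
  exact tendsto_nhds_unique hs.hasSum.tendsto_sum_nat
    (hlim.congr fun n => (hpart n).symm) ▸ hs.hasSum

/-- The case `x = 1`, where `(x; q²)_∞ = 0`. -/
theorem tsum_theta_eq {q : ℂ} (hq : ‖q‖ < 1) :
    ∑' n : ℕ, (-1) ^ n * q ^ n ^ 2 =
      1 - ∑' k : ℕ, q ^ (2 * k + 1) * qPochInf (q ^ (2 * k + 2)) q := by
  have h1 := thetaPochSum_add_gapPochSum hq 1
  rw [qPochInf_eq_one_sub_mul (norm_sq_lt_one hq) 1] at h1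
  have hs := hasSum_pow_mul_qPochInf hq
  have he : Summable fun k : ℕ => q ^ (2 * k) * qPochInf (q ^ (2 * k + 1)) q :=
    hs.summable.comp_injective (i := fun k : ℕ => 2 * k) fun a b h => by simpa using h
  have ho : Summable fun k : ℕ => q ^ (2 * k + 1) * qPochInf (q ^ (2 * k + 2)) q :=
    hs.summable.comp_injective (i := fun k : ℕ => 2 * k + 1) fun a b h => by simpa using h
  have hsum := (HasSum.even_add_odd (f := fun m : ℕ => q ^ m * qPochInf (q ^ (m + 1)) q)
    he.hasSum ho.hasSum).unique hs
  simp only [gapPochSum, one_mul] at h1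
  linear_combination -h1 + hsum

/-! ### The series for `φ(-q)` -/

theorem qPoch_neg_sq_ne_zero {q : ℂ} (hq : ‖q‖ < 1) (n : ℕ) : qPoch (-q ^ 2) (q ^ 2) n ≠ 0 := by
  refine prod_ne_zero_iff.2 fun k _ h => ?_
  have h1 : (q ^ 2) ^ (k + 1) = -1 := by linear_combination h
  have h2 : ‖(q ^ 2) ^ (k + 1)‖ < 1 := by
    rw [norm_pow]
    exact pow_lt_one₀ (norm_nonneg _) (norm_sq_lt_one hq) k.succ_ne_zero
  simp [h1] at h2

theorem qPochInf_neg_sq_ne_zero {q : ℂ} (hq : ‖q‖ < 1) : qPochInf (-q ^ 2) (q ^ 2) ≠ 0 := by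
  have hq2 := norm_sq_lt_one hq
  have := tprod_one_add_ne_zero_of_summable (f := fun k : ℕ => -(-q ^ 2 * (q ^ 2) ^ k))
    (fun k h => ?_) (summable_norm_mul_pow hq2 _)
  · simpa [qPochInf, sub_eq_add_neg] using this
  · refine qPoch_neg_sq_ne_zero hq (k + 1) ?_
    rw [qPoch, prod_range_succ, sub_eq_add_neg 1 (_ * (q ^ 2) ^ k), h, mul_zero]

theorem qPochInf_mul_mockPhiTerm {q : ℂ} (hq : ‖q‖ < 1) (n : ℕ) :
    qPochInf (-q ^ 2) (q ^ 2) * mockPhiTerm (-q) n =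
      (-1) ^ n * q ^ n ^ 2 * qPochInf (-q * q ^ (2 * n + 1)) (q ^ 2) := by
  have hne := qPoch_neg_sq_ne_zero hq n
  have hpow : (-q) ^ n ^ 2 = (-1) ^ n * q ^ n ^ 2 := by
    rw [neg_pow]
    congr 1
    rcases Nat.even_or_odd n with h | h
    · rw [h.neg_one_pow, (h.pow_of_ne_zero two_ne_zero).neg_one_pow]
    · rw [h.neg_one_pow, h.pow.neg_one_pow]
  have harg : -q ^ 2 * (q ^ 2) ^ n = -q * q ^ (2 * n + 1) := by ring
  rw [mockPhiTerm, neg_sq, qPochInf_eq_qPoch_mul (norm_sq_lt_one hq) (-q ^ 2) n, hpow, harg]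
  field_simp

theorem summable_mockPhiTerm {q : ℂ} (hq : ‖q‖ < 1) : Summable (mockPhiTerm (-q)) := by
  rw [← summable_mul_left_iff (qPochInf_neg_sq_ne_zero hq)]
  exact (summable_thetaPochSum hq (-q)).congr fun n => (qPochInf_mul_mockPhiTerm hq n).symm

/-- The case `x = -q`, combined with the case `x = 1`. -/
theorem qPochInf_mul_mockPhi {q : ℂ} (hq : ‖q‖ < 1) :
    qPochInf (-q) q * mockPhi (-q) =
      1 + (∑' k : ℕ, q ^ (2 * k + 1) * qPochInf (-q ^ (2 * k + 2)) q -
        ∑' k : ℕ, q ^ (2 * k + 1) * qPochInf (q ^ (2 * k + 2)) q) := by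
  have h := thetaPochSum_add_gapPochSum hq (-q)
  have hphi : qPochInf (-q ^ 2) (q ^ 2) * mockPhi (-q) = thetaPochSum q (-q) := by
    rw [mockPhi, ← tsum_mul_left]
    exact tsum_congr fun n => qPochInf_mul_mockPhiTerm hq n
  have hgap : gapPochSum q (-q) = -∑' k : ℕ, q ^ (2 * k + 1) * qPochInf (-q ^ (2 * k + 2)) q := by
    rw [gapPochSum, ← tsum_neg]
    refine tsum_congr fun k => ?_
    rw [show -q * q ^ (2 * k + 1) = -q ^ (2 * k + 2) by ring]
    ring
  rw [tsum_theta_eq hq, hgap] at h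
  rw [← qPochInf_sq_mul_qPochInf_sq hq (-q), show -q * q = -q ^ 2 by ring]
  linear_combination h + qPochInf (-q) (q ^ 2) * hphi

/-! ### Partitions into distinct parts with odd smallest part -/

/-- The parts of the partition encoded by `(k, s)`: the smallest part `2k + 1`, and a part
`i + (2k + 2)` for each `i ∈ s`. -/
def oddMinParts (x : ℕ × Finset ℕ) : Multiset ℕ :=
  (2 * x.1 + 1) ::ₘ (x.2.map (addRightEmbedding (2 * x.1 + 2))).val

theorem sum_oddMinParts (x : ℕ × Finset ℕ) :
    (oddMinParts x).sum = (2 * x.1 + 1) + ∑ i ∈ x.2, (i + (2 * x.1 + 2)) := by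
  simp [oddMinParts]

theorem card_oddMinParts (x : ℕ × Finset ℕ) : (oddMinParts x).card = x.2.card + 1 := by
  simp [oddMinParts]

theorem le_of_mem_oddMinParts {x : ℕ × Finset ℕ} {j : ℕ} (hj : j ∈ oddMinParts x) :
    2 * x.1 + 1 ≤ j := by
  simp only [oddMinParts, Multiset.mem_cons, mem_val, Finset.mem_map, addRightEmbedding_apply] at hj
  rcases hj with rfl | ⟨i, -, rfl⟩ <;> omega

theorem nodup_oddMinParts (x : ℕ × Finset ℕ) : (oddMinParts x).Nodup := by
  refine Multiset.nodup_cons.2 ⟨fun h => ?_, Finset.nodup _⟩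
  simp only [mem_val, Finset.mem_map, addRightEmbedding_apply] at h
  obtain ⟨i, -, hi⟩ := h
  omega

theorem oddMinParts_injective : Function.Injective oddMinParts := by
  rintro ⟨k, s⟩ ⟨l, t⟩ h
  have hk : 2 * l + 1 ≤ 2 * k + 1 :=
    le_of_mem_oddMinParts (x := (l, t)) (h ▸ Multiset.mem_cons_self _ _)
  have hl : 2 * k + 1 ≤ 2 * l + 1 :=
    le_of_mem_oddMinParts (x := (k, s)) (h ▸ Multiset.mem_cons_self _ _)
  obtain rfl : k = l := by omega
  rw [oddMinParts, oddMinParts, Multiset.cons_inj_right, Finset.val_inj, Finset.map_inj] at h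
  exact congrArg (Prod.mk k) h

theorem exists_oddMinParts_eq {P : Multiset ℕ} (hP : P.Nodup) {m : ℕ} (hm : m ∈ P)
    (hmin : ∀ i ∈ P, m ≤ i) (hodd : Odd m) : ∃ x, oddMinParts x = P := by
  obtain ⟨k, rfl⟩ := hodd
  obtain ⟨R, rfl⟩ := Multiset.exists_cons_of_mem hm
  obtain ⟨hkR, hR⟩ := Multiset.nodup_cons.1 hP
  have hge : ∀ i ∈ R, 2 * k + 2 ≤ i := fun i hi => by
    have h1 := hmin i (Multiset.mem_cons_of_mem hi)
    have h2 : i ≠ 2 * k + 1 := fun h => hkR (h ▸ hi)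
    omega
  refine ⟨(k, (⟨R, hR⟩ : Finset ℕ).image (· - (2 * k + 2))), ?_⟩
  rw [oddMinParts, Multiset.cons_inj_right]
  change _ = (⟨R, hR⟩ : Finset ℕ).val
  rw [Finset.val_inj]
  ext j
  simp only [Finset.mem_map, mem_image, addRightEmbedding_apply, mem_mk]
  constructor
  · rintro ⟨_, ⟨i, hi, rfl⟩, rfl⟩
    rwa [Nat.sub_add_cancel (hge i hi)]
  · exact fun hj => ⟨_, ⟨j, hj, rfl⟩, Nat.sub_add_cancel (hge j hj)⟩

theorem pEvenDO_eq_card (n : ℕ) :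
    pEvenDO n = Nat.card ((fun x : {x : ℕ × Finset ℕ | Odd x.2.card} =>
      (oddMinParts x).sum) ⁻¹' {n}) := by
  symm
  refine Nat.card_eq_of_bijective (fun y => ⟨⟨oddMinParts y.1, fun hi =>
    (Nat.succ_pos _).trans_le (le_of_mem_oddMinParts hi), y.2⟩, nodup_oddMinParts _, ?_,
    2 * y.1.1.1 + 1, Multiset.mem_cons_self _ _, fun i hi => le_of_mem_oddMinParts hi, by simp⟩)
    ⟨?_, ?_⟩
  · rw [card_oddMinParts]
    exact y.1.2.add_one
  · intro y z h
    have h' : oddMinParts y.1 = oddMinParts z.1 := congrArg (fun p => p.1.parts) h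
    exact Subtype.ext (Subtype.ext (oddMinParts_injective h'))
  · rintro ⟨p, hnd, heven, m, hm, hmin, hodd⟩
    obtain ⟨x, hx⟩ := exists_oddMinParts_eq hnd hm hmin hodd
    rw [← hx, card_oddMinParts, Nat.even_add_one, Nat.not_even_iff_odd] at heven
    refine ⟨⟨⟨x, heven⟩, ?_⟩, ?_⟩
    · simpa [hx] using p.parts_sum
    · exact Subtype.ext (Nat.Partition.ext hx)

theorem pEvenDO_zero : pEvenDO 0 = 0 := by
  rw [pEvenDO_eq_card, Nat.card_eq_zero]
  left
  refine ⟨fun ⟨x, hx⟩ => ?_⟩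
  have := sum_oddMinParts x.1
  simp only [Set.mem_preimage, Set.mem_singleton_iff] at hx
  omega

/-! ### Generating functions -/

theorem hasSum_prod_qPochInf {q : ℂ} (hq : ‖q‖ < 1) (a : ℂ) :
    HasSum (fun s : Finset ℕ => ∏ i ∈ s, -(a * q ^ i)) (qPochInf a q) := by
  have hs := summable_finsetProd_of_summable_norm (summable_norm_mul_pow hq a)
  have := tprod_one_add hs
  simp only [← sub_eq_add_neg] at this
  rw [qPochInf, this]
  exact hs.hasSum

theorem prod_mul_pow_eq (c q : ℂ) (x : ℕ × Finset ℕ) :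
    q ^ (2 * x.1 + 1) * ∏ i ∈ x.2, -(-c * q ^ (2 * x.1 + 2) * q ^ i) =
      c ^ x.2.card * q ^ (oddMinParts x).sum := by
  have h : ∀ i ∈ x.2, -(-c * q ^ (2 * x.1 + 2) * q ^ i) = c * q ^ (i + (2 * x.1 + 2)) :=
    fun i _ => by ring
  rw [prod_congr rfl h, prod_mul_distrib, prod_const, prod_pow_eq_pow_sum, sum_oddMinParts,
    pow_add q (2 * x.1 + 1)]
  ring

theorem summable_pow_sum_oddMinParts {r : ℝ} (h0 : 0 ≤ r) (h1 : r < 1) :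
    Summable fun x : ℕ × Finset ℕ => r ^ (oddMinParts x).sum := by
  have hg := summable_geometric_of_lt_one h0 h1
  have hp : Summable fun s : Finset ℕ => ∏ i ∈ s, r ^ i :=
    summable_finsetProd_of_summable_nonneg (fun i => pow_nonneg h0 i) hg
  refine (hg.mul_of_nonneg hp (fun k => pow_nonneg h0 k)
    fun s => prod_nonneg fun i _ => pow_nonneg h0 i).of_nonneg_of_le
    (fun x => pow_nonneg h0 _) fun x => ?_
  rw [prod_pow_eq_pow_sum, ← pow_add]
  refine pow_le_pow_of_le_one h0 h1.le ?_
  rw [sum_oddMinParts]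
  exact add_le_add (by omega) (sum_le_sum fun i _ => Nat.le_add_right _ _)

/-- The weight `c` marks the parts other than the smallest. -/
theorem hasSum_oddMinParts {q c : ℂ} (hq : ‖q‖ < 1) (hc : ‖c‖ = 1) :
    HasSum (fun x : ℕ × Finset ℕ => c ^ x.2.card * q ^ (oddMinParts x).sum)
      (∑' k : ℕ, q ^ (2 * k + 1) * qPochInf (-c * q ^ (2 * k + 2)) q) := by
  have hs : Summable fun x : ℕ × Finset ℕ => c ^ x.2.card * q ^ (oddMinParts x).sum :=
    (summable_pow_sum_oddMinParts (norm_nonneg q) hq).of_norm_bounded fun x => by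
      simp [hc]
  have h := hs.hasSum.prod_fiberwise fun k =>
    ((hasSum_prod_qPochInf hq (-c * q ^ (2 * k + 2))).mul_left (q ^ (2 * k + 1))).congr_fun
      fun s => (prod_mul_pow_eq c q (k, s)).symm
  rw [h.tsum_eq]
  exact hs.hasSum

/-- The difference of the generating functions without and with the sign `(-1)^|s|` keeps, twice,
the pairs with `|s|` odd, that is, the partitions with an even number of parts. -/
theorem hasSum_pEvenDO {q : ℂ} (hq : ‖q‖ < 1) :
    HasSum (fun n : ℕ => (pEvenDO n : ℂ) * q ^ n)
      ((∑' k : ℕ, q ^ (2 * k + 1) * qPochInf (-q ^ (2 * k + 2)) q -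
        ∑' k : ℕ, q ^ (2 * k + 1) * qPochInf (q ^ (2 * k + 2)) q) / 2) := by
  have hp := hasSum_oddMinParts (c := 1) hq (by simp)
  have hm := hasSum_oddMinParts (c := -1) hq (by simp)
  simp only [one_pow, neg_mul, one_mul, neg_neg] at hp hm
  have hodd : HasSum ((fun x : ℕ × Finset ℕ => q ^ (oddMinParts x).sum) ∘
      ((↑) : {x : ℕ × Finset ℕ | Odd x.2.card} → ℕ × Finset ℕ))
      ((∑' k : ℕ, q ^ (2 * k + 1) * qPochInf (-q ^ (2 * k + 2)) q -
        ∑' k : ℕ, q ^ (2 * k + 1) * qPochInf (q ^ (2 * k + 2)) q) / 2) := by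
    rw [hasSum_subtype_iff_indicator]
    refine ((hp.sub hm).div_const 2).congr_fun fun x => ?_
    by_cases hx : Odd x.2.card
    · rw [Set.indicator_of_mem (by exact hx), hx.neg_one_pow]
      ring
    · rw [Set.indicator_of_notMem (by exact hx), (Nat.not_odd_iff_even.1 hx).neg_one_pow]
      ring
  refine (hodd.tsum_fiberwise fun x => (oddMinParts x).sum).congr_fun fun n => ?_
  have hconst : ∀ y : ((fun x : {x : ℕ × Finset ℕ | Odd x.2.card} =>
      (oddMinParts x).sum) ⁻¹' {n}), q ^ (oddMinParts y.1).sum = q ^ n := fun y => by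
    rw [show (oddMinParts y.1).sum = n from y.2]
  simp only [Function.comp_apply]
  rw [tsum_congr hconst, tsum_const, pEvenDO_eq_card, nsmul_eq_mul]

/-- For every complex `q` with `|q| < 1`, the infinite product `(-q;q)_∞` and the two series
converge absolutely, no denominator of `φ(-q)` vanishes, and
`(-q;q)_∞ φ(-q) = 1 + 2 ∑_{n ≥ 1} p^e_do(n) q^n`. -/
theorem theorem1p5 (q : ℂ) (hq : ‖q‖ < 1) :
    Multipliable (fun k : ℕ => 1 - (-q) * q ^ k) ∧
    (∀ n : ℕ, qPoch (-(-q) ^ 2) ((-q) ^ 2) n ≠ 0) ∧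
    Summable (mockPhiTerm (-q)) ∧
    Summable (fun n : ℕ => (pEvenDO (n + 1) : ℂ) * q ^ (n + 1)) ∧
    qPochInf (-q) q * mockPhi (-q) =
      1 + 2 * ∑' n : ℕ, (pEvenDO (n + 1) : ℂ) * q ^ (n + 1) := by
  have hsum := hasSum_pEvenDO hq
  have hshift := hsum.summable.tsum_eq_zero_add
  rw [hsum.tsum_eq, pEvenDO_zero, Nat.cast_zero, zero_mul, zero_add] at hshift
  refine ⟨multipliable_one_sub_mul_pow hq (-q), fun n => ?_, summable_mockPhiTerm hq,
    (summable_nat_add_iff 1).2 hsum.summable, ?_⟩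
  · rw [neg_sq]
    exact qPoch_neg_sq_ne_zero hq n
  · rw [qPochInf_mul_mockPhi hq, ← hshift]
    ring
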